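/- Let $\mathfrak X\subseteq\mathcal P(\mathbb N)$ be a Scott set, i.e. a Boolean algebra of subsets of $\mathbb N$ such that (a) if $A\in\mathfrak X$ and $B\subseteq\mathbb N$ is Turing computable from $A$, then $B\in\mathfrak X$; and (b) if $T\subseteq 2^{<\omega}$ is an infinite binary tree coded by a set in $\mathfrak X$, then $\mathfrak X$ contains a set coding an infinite path through $T$. Let $\mathfrak X/\mathrm{Fin}$ be the poset of infinite sets in $\mathfrak X$ ordered by almost inclusion: $A\le B$ iff $A\setminus B$ is finite. A sequence $\langle B_n\mid n\in\mathbb N\rangle$ of subsets of $\mathbb N$ is coded in $\mathfrak X$ if there is $B\in\mathfrak X$ with $B_n=\{m\mid\langle n,m\rangle\in B\}$ for all $n$, where $\langle\cdot,\cdot\rangle$ is a fixed computable pairing function. A set $C\in\mathfrak X/\mathrm{Fin}$ decides such a sequence if for every ultrafilter $U$ on the Boolean algebra $\mathfrak X$ with $C\in U$ we have $\{n\in\mathbb N\mid B_n\in U\}\in\mathfrak X$. Then the following are equivalent: 1. $\mathfrak X$ is arithmetically closed: every $B\subseteq\mathbb N$ that is first-order definable in the structure $\langle\mathbb N,0,1,+,\cdot,<,A\rangle_{A\in\mathfrak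 X}$, with a unary predicate for each $A\in\mathfrak X$, belongs to $\mathfrak X$. 2. $\mathfrak X$ is decisive: for every sequence $\langle B_n\mid n\in\mathbb N\rangle$ coded in $\mathfrak X$, the set of $C\in\mathfrak X/\mathrm{Fin}$ that decide it is dense in $\mathfrak X/\mathrm{Fin}$, i.e. below every $A\in\mathfrak X/\mathrm{Fin}$ there is such a $C$. 3. For every sequence $\langle B_n\mid n\in\mathbb N\rangle$ coded in $\mathfrak X$, there is $C\in\mathfrak X/\mathrm{Fin}$ that decides it. -/

import Mathlib

namespace ScottSets

/-- The characteristic function of `A ⊆ ℕ`, as a (total) element of `ℕ →. ℕ`. -/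
noncomputable def charFn (A : Set ℕ) : ℕ →. ℕ :=
  fun n => Part.some (A.indicator (fun _ => 1) n)

/-- A binary tree: a set of finite binary sequences closed under initial segments. -/
def IsBinaryTree (T : Set (List Bool)) : Prop :=
  ∀ s t : List Bool, s <+: t → t ∈ T → s ∈ T

/-- The set of natural numbers coding a set of finite binary sequences. -/
def treeCode (T : Set (List Bool)) : Set ℕ :=
  Encodable.encode '' T

open Classical in
/-- The initial segment of length `n` of the infinite binary sequence
with characteristic set `P`. -/
noncomputable def restrict (P : Set ℕ) (n : ℕ) : List Bool :=
  (List.range n).map fun i => decide (i ∈ P)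

/-- `P`, viewed as an infinite binary sequence, is a path (cofinal branch) through `T`. -/
def IsPath (T : Set (List Bool)) (P : Set ℕ) : Prop :=
  ∀ n, restrict P n ∈ T

/-- A Scott set: a Boolean algebra of subsets of `ℕ`, closed under Turing reducibility, that
contains a path through every infinite binary tree that it codes. -/
structure IsScottSet (X : Set (Set ℕ)) : Prop where
  isSetAlgebra : MeasureTheory.IsSetAlgebra X
  mem_of_turingReducible : ∀ A ∈ X, ∀ B : Set ℕ, TuringReducible (charFn B) (charFn A) → B ∈ X
  exists_path : ∀ T : Set (List Bool), IsBinaryTree T → T.Infinite → treeCode T ∈ X →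
    ∃ P ∈ X, IsPath T P

/-- Function symbols of the language of arithmetic. -/
inductive ArithFunc : ℕ → Type
  | zero : ArithFunc 0
  | one : ArithFunc 0
  | add : ArithFunc 2
  | mul : ArithFunc 2

/-- Relation symbols: `<`, and a unary predicate for every `A ∈ S`. -/
inductive ArithRel (S : Set (Set ℕ)) : ℕ → Type
  | lt : ArithRel S 2
  | pred (A : S) : ArithRel S 1

/-- The language of arithmetic `{0, 1, +, ·, <}` expanded by unary predicates for all `A ∈ S`. -/
def arithLang (S : Set (Set ℕ)) : FirstOrder.Language where
  Functions := ArithFunc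
  Relations := ArithRel S

/-- The structure `⟨ℕ, A⟩_{A ∈ S}` with its natural interpretation. -/
instance arithStructure (S : Set (Set ℕ)) : (arithLang S).Structure ℕ where
  funMap {_} f :=
    match f with
    | ArithFunc.zero => fun _ => 0
    | ArithFunc.one => fun _ => 1
    | ArithFunc.add => fun v => v 0 + v 1
    | ArithFunc.mul => fun v => v 0 * v 1
  RelMap {_} r :=
    match r with
    | ArithRel.lt => fun v => v 0 < v 1
    | ArithRel.pred A => fun v => v 0 ∈ (A : Set ℕ)

/-- `S` is arithmetically closed: every subset of `ℕ` definable in `⟨ℕ, A⟩_{A ∈ S}` is in `S`.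
(Definability with parameters is the same thing, as every natural number is the value of a
closed term.) -/
def ArithmeticallyClosed (S : Set (Set ℕ)) : Prop :=
  ∀ B : Set ℕ, (∅ : Set ℕ).Definable₁ (arithLang S) B → B ∈ S

/-- The poset `X/Fin`: the infinite sets in `X`. -/
def ModFin (X : Set (Set ℕ)) : Type :=
  {A : Set ℕ // A ∈ X ∧ A.Infinite}

/-- `X/Fin` is ordered by almost inclusion. -/
instance ModFin.instPreorder (X : Set (Set ℕ)) : Preorder (ModFin X) where
  le A B := (A.1 \ B.1).Finite
  le_refl A := by simp
  le_trans A B C hAB hBC := (hAB.union hBC).subset fun x hx => by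
    by_cases h : x ∈ B.1
    · exact Or.inr ⟨h, hx.2⟩
    · exact Or.inl ⟨hx.1, h⟩

/-- `D` is dense in the poset `P`. -/
def IsDenseIn {P : Type} [Preorder P] (D : Set P) : Prop :=
  ∀ a : P, ∃ c ∈ D, c ≤ a

/-- An ultrafilter on the Boolean algebra of sets `X`. -/
structure IsUltrafilterOn (X U : Set (Set ℕ)) : Prop where
  subset : U ⊆ X
  univ_mem : Set.univ ∈ U
  empty_notMem : ∅ ∉ U
  inter_mem : ∀ A ∈ U, ∀ B ∈ U, A ∩ B ∈ U
  mem_of_superset : ∀ A ∈ U, ∀ B ∈ X, A ⊆ B → B ∈ U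
  mem_or_compl_mem : ∀ A ∈ X, A ∈ U ∨ Aᶜ ∈ U

/-- The sequence `⟨B n⟩` is coded in `X`. -/
def CodedIn (X : Set (Set ℕ)) (B : ℕ → Set ℕ) : Prop :=
  ∃ B' ∈ X, ∀ n, B n = {m | Nat.pair n m ∈ B'}

/-- `C ∈ X/Fin` decides the sequence `⟨B n⟩`. -/
def Decides {X : Set (Set ℕ)} (C : ModFin X) (B : ℕ → Set ℕ) : Prop :=
  ∀ U : Set (Set ℕ), IsUltrafilterOn X U → C.1 ∈ U → {n | B n ∈ U} ∈ X

/-- `X` is decisive: for every coded sequence, the conditions deciding it are dense. -/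
def Decisive (X : Set (Set ℕ)) : Prop :=
  ∀ B : ℕ → Set ℕ, CodedIn X B → IsDenseIn {C : ModFin X | Decides C B}

end ScottSets

/-!
A Turing ideal is arithmetically closed if and only if it is closed under projection, that is, if
it is a jump ideal.

In a jump ideal, given an infinite set `A` and a coded sequence `B`, consider the binary strings `σ`
for which infinitely many `m ∈ A` have the membership pattern `σ` in the first terms of `B`. These
strings form a coded tree without dead ends, so its leftmost path `P` lies in the ideal. An infinite
`C ⊆ A` whose members eventually have the pattern `P` can be picked greedily; every nonprincipal
ultrafilter containing `C` then contains exactly those `B n` with `n ∈ P`, while a principal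
ultrafilter reads off a column of the code of `B`.

Conversely, the projection of `A` is recovered by deciding the sequence
`B n = {m | ∃ k < m, ⟨n, k⟩ ∈ A}`. Each `B n` is cofinite or empty, so a nonprincipal ultrafilter
contains `B n` exactly when `n` belongs to the projection.
-/

/-! ### Coded predicates -/

namespace ScottSets

open Encodable Filter

variable {X : Set (Set ℕ)} {A : Set ℕ}

theorem turingReducible_charFn_preimage {f : ℕ → ℕ} (hf : Computable f) :
    TuringReducible (charFn (f ⁻¹' A)) (charFn A) := by
  have hcomp := Nat.RecursiveIn.comp (.oracle (O := {charFn A}) (charFn A) rfl)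
    (Nat.Partrec.recursiveIn (Partrec.nat_iff.1 hf))
  exact RecursiveIn.iff_nat.2 (hcomp.of_eq fun n => Part.bind_some (f n) (charFn A))

theorem partrec_charFn {p : ℕ → Prop} (hp : ComputablePred p) : Partrec (charFn {n | p n}) := by
  obtain ⟨_, hp⟩ := hp
  refine (Computable.cond hp (.const 1) (.const 0)).partrec.of_eq fun n => ?_
  by_cases hn : p n <;> simp [charFn, hn]

/-- The bounded projection of `A`: the codes of the pairs `(n, m)` such that `A` contains the code
of `(n, k)` for some `k < m`. It is the set-theoretic form of a bounded quantifier. -/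
def boundedProj (A : Set ℕ) : Set ℕ :=
  {q | ∃ k < q.unpair.2, Nat.pair q.unpair.1 k ∈ A}

theorem pair_mem_boundedProj {n m : ℕ} :
    Nat.pair n m ∈ boundedProj A ↔ ∃ k < m, Nat.pair n k ∈ A := by
  simp [boundedProj]

theorem pair_succ_mem_boundedProj {n m : ℕ} :
    Nat.pair n (m + 1) ∈ boundedProj A ↔ Nat.pair n m ∈ boundedProj A ∨ Nat.pair n m ∈ A := by
  simp only [pair_mem_boundedProj, Nat.exists_lt_succ_right]

theorem turingReducible_charFn_boundedProj :
    TuringReducible (charFn (boundedProj A)) (charFn A) := by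
  have hidx : Primrec fun q : ℕ => Nat.pair q.unpair.1 q.unpair.2.unpair.1 :=
    Primrec₂.natPair.comp (.comp .fst .unpair) (.comp .fst (.comp .unpair (.comp .snd .unpair)))
  have hacc : Primrec fun q : ℕ => q.unpair.2.unpair.2 :=
    .comp .snd (.comp .unpair (.comp .snd .unpair))
  have hmax : Primrec fun q : ℕ => max q.unpair.1 q.unpair.2 :=
    Primrec.nat_max.comp (.comp .fst .unpair) (.comp .snd .unpair)
  have hstep := Nat.RecursiveIn.comp (Nat.Primrec.recursiveIn (Primrec.nat_iff.1 hmax))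
    (.pair (Nat.Primrec.recursiveIn (Primrec.nat_iff.1 hacc))
      (RecursiveIn.iff_nat.1 (turingReducible_charFn_preimage (A := A) hidx.to_comp)))
  refine RecursiveIn.iff_nat.2 ((Nat.RecursiveIn.prec .zero hstep).of_eq fun q => ?_)
  obtain ⟨⟨n, m⟩, rfl⟩ := Nat.pairEquiv.surjective q
  simp only [Nat.pairEquiv_apply, Function.uncurry_apply_pair, Nat.unpair_pair]
  induction m with
  | zero =>
    exact congrArg Part.some (Set.indicator_of_notMem (by simp [pair_mem_boundedProj]) _).symm
  | succ m ih =>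
    refine (congrArg (Part.bind · _) ih).trans ((Part.bind_some _ _).trans ?_)
    by_cases hm : Nat.pair n m ∈ A <;> by_cases hlt : Nat.pair n m ∈ boundedProj A <;>
      simp [charFn, Seq.seq, pair_succ_mem_boundedProj, hm, hlt]

/-- A Turing ideal: a Boolean algebra of subsets of `ℕ` that is closed under Turing reducibility.
Closure under unions stands in for the usual closure under joins. -/
class IsTuringIdeal (X : Set (Set ℕ)) : Prop where
  isSetAlgebra : MeasureTheory.IsSetAlgebra X
  mem_of_turingReducible : ∀ A ∈ X, ∀ B : Set ℕ, TuringReducible (charFn B) (charFn A) → B ∈ X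

theorem IsScottSet.isTuringIdeal (hX : IsScottSet X) : IsTuringIdeal X where
  isSetAlgebra := hX.isSetAlgebra
  mem_of_turingReducible := hX.mem_of_turingReducible

/-- A jump ideal: a Turing ideal closed under the Turing jump. The jump is replaced by projection
along the second coordinate: `A'` is the projection of a set computable from `A`, and every
projection of `A` is computable from `A'`. -/
class IsJumpIdeal (X : Set (Set ℕ)) : Prop extends IsTuringIdeal X where
  proj_mem : ∀ A ∈ X, {n | ∃ m, Nat.pair n m ∈ A} ∈ X

/-- The predicate `p` on an encodable type is coded in `X`: some member of `X` consists, as far as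
codes of elements are concerned, of the codes of the elements satisfying `p`. Numbers that are not
codes are unconstrained. Closure properties of ideals take the form of logical operations on coded
predicates. -/
def Codes (X : Set (Set ℕ)) {α : Type*} [Primcodable α] (p : α → Prop) : Prop :=
  ∃ A ∈ X, ∀ a, p a ↔ encode a ∈ A

namespace Codes

variable {α β : Type*} [Primcodable α] [Primcodable β] {p q : α → Prop}

theorem nat_iff {p : ℕ → Prop} : Codes X p ↔ {n | p n} ∈ X := by
  refine ⟨fun ⟨A, hA, hp⟩ => ?_, fun hp => ⟨_, hp, fun _ => Iff.rfl⟩⟩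
  rwa [show {n | p n} = A from Set.ext hp]

theorem codedIn_iff {B : ℕ → Set ℕ} : CodedIn X B ↔ Codes X fun q : ℕ × ℕ => q.2 ∈ B q.1 := by
  simp only [CodedIn, Codes, Prod.forall, Set.ext_iff, Set.mem_ofPred_eq, Encodable.encode_prod_val,
    Encodable.encode_nat]

theorem of_iff (hp : Codes X p) (h : ∀ a, q a ↔ p a) : Codes X q := by
  rwa [funext fun a => propext (h a)]

section TuringIdeal

variable [IsTuringIdeal X]

theorem not (hp : Codes X p) : Codes X fun a => ¬ p a := by
  obtain ⟨A, hA, hp⟩ := hp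
  exact ⟨Aᶜ, IsTuringIdeal.isSetAlgebra.compl_mem hA, fun a => (hp a).not⟩

theorem or (hp : Codes X p) (hq : Codes X q) : Codes X fun a => p a ∨ q a := by
  obtain ⟨A, hA, hp⟩ := hp
  obtain ⟨B, hB, hq⟩ := hq
  exact ⟨A ∪ B, IsTuringIdeal.isSetAlgebra.union_mem hA hB, fun a => or_congr (hp a) (hq a)⟩

theorem and (hp : Codes X p) (hq : Codes X q) : Codes X fun a => p a ∧ q a :=
  (hp.not.or hq.not).not.of_iff fun _ => by tauto

theorem imp (hp : Codes X p) (hq : Codes X q) : Codes X fun a => p a → q a :=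
  (hp.not.or hq).of_iff fun _ => by tauto

theorem iff (hp : Codes X p) (hq : Codes X q) : Codes X fun a => (p a ↔ q a) :=
  ((hp.imp hq).and (hq.imp hp)).of_iff fun _ => by tauto

theorem comp (hp : Codes X p) {f : β → α} (hf : Computable f) : Codes X fun b => p (f b) := by
  obtain ⟨A, hA, hp⟩ := hp
  have hg : Computable fun n : ℕ => (encode ((decode (α := β) n).map f)).pred :=
    Primrec.pred.to_comp.comp (Computable.encode.comp
      (Computable.option_map Computable.decode (hf.comp Computable.snd).to₂))
  exact ⟨_, IsTuringIdeal.mem_of_turingReducible A hA _ (turingReducible_charFn_preimage hg),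
    fun b => by simp [hp]⟩

theorem mem (hA : A ∈ X) {f : α → ℕ} (hf : Computable f) : Codes X fun a => f a ∈ A :=
  (nat_iff.2 hA : Codes X (· ∈ A)).comp hf

theorem of_computablePred (hp : ComputablePred p) : Codes X p := by
  obtain ⟨_, hp⟩ := hp
  have hone : {n : ℕ | n = 1} ∈ X :=
    IsTuringIdeal.mem_of_turingReducible ∅ IsTuringIdeal.isSetAlgebra.empty_mem _
      (partrec_charFn (PrimrecPred.computablePred (Primrec.eq.comp .id (.const 1)))).turingReducible
  refine (mem hone (Computable.cond hp (.const 1) (.const 0))).of_iff fun a => ?_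
  by_cases ha : p a <;> simp [ha]

theorem of_primrecPred (hp : PrimrecPred p) : Codes X p :=
  of_computablePred hp.computablePred

theorem exists_lt {p : α × ℕ → Prop} (hp : Codes X p) {f : α → ℕ} (hf : Computable f) :
    Codes X fun a => ∃ k < f a, p (a, k) := by
  obtain ⟨A, hA, hp⟩ := hp
  have hproj : boundedProj A ∈ X :=
    IsTuringIdeal.mem_of_turingReducible A hA _ turingReducible_charFn_boundedProj
  have hpair : Computable fun a => Nat.pair (encode a) (f a) :=
    Primrec₂.natPair.to_comp.comp Computable.encode hf
  exact (mem hproj hpair).of_iff fun a => by simp [pair_mem_boundedProj, hp]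

theorem forall_lt {p : α × ℕ → Prop} (hp : Codes X p) {f : α → ℕ} (hf : Computable f) :
    Codes X fun a => ∀ k < f a, p (a, k) :=
  (hp.not.exists_lt hf).not.of_iff fun a => by push Not; rfl

end TuringIdeal

section JumpIdeal

variable [IsJumpIdeal X]

theorem exists_nat {p : α × ℕ → Prop} (hp : Codes X p) : Codes X fun a => ∃ k, p (a, k) := by
  obtain ⟨A, hA, hp⟩ := hp
  exact ⟨_, IsJumpIdeal.proj_mem A hA, fun a => by simp [hp]⟩

theorem ex [Nonempty β] {p : α × β → Prop} (hp : Codes X p) : Codes X fun a => ∃ b, p (a, b) := by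
  inhabit β
  have hdecode : Computable fun r : α × ℕ => (r.1, (decode (α := β) r.2).getD default) :=
    Computable.fst.pair (Computable.option_getD (Computable.decode.comp .snd) (.const default))
  refine (hp.comp hdecode).exists_nat.of_iff fun a => ⟨fun ⟨b, hb⟩ => ⟨encode b, ?_⟩,
    fun ⟨k, hk⟩ => ⟨_, hk⟩⟩
  simpa using hb

theorem all [Nonempty β] {p : α × β → Prop} (hp : Codes X p) : Codes X fun a => ∀ b, p (a, b) :=
  hp.not.ex.not.of_iff fun a => by push Not; rfl

end JumpIdeal

end Codes

/-! ### Arithmetical closure -/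

open FirstOrder Language

theorem computable_realize_term {S : Set (Set ℕ)} {k n : ℕ}
    (t : (arithLang S).Term (Fin k ⊕ Fin n)) :
    Computable fun v : (Fin k → ℕ) × (Fin n → ℕ) => t.realize (Sum.elim v.1 v.2) := by
  induction t with
  | var i =>
    rcases i with i | i
    · exact (Primrec.fin_app.comp .fst (.const i)).to_comp
    · exact (Primrec.fin_app.comp .snd (.const i)).to_comp
  | func f ts ih =>
    cases f with
    | zero => exact .const 0
    | one => exact .const 1
    | add => exact Primrec.nat_add.to_comp.comp (ih 0) (ih 1)
    | mul => exact Primrec.nat_mul.to_comp.comp (ih 0) (ih 1)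

theorem primrec_finSnoc {α : Type*} [Primcodable α] (n : ℕ) :
    Primrec₂ fun (v : Fin n → α) (a : α) => (Fin.snoc v a : Fin (n + 1) → α) := by
  refine Primrec.fin_curry.2 (Primrec₂.swap (Primrec.fin_curry₁.2 fun i => ?_))
  induction i using Fin.lastCases with
  | last => simpa using Primrec.snd
  | cast i => simpa using Primrec.fin_app.comp .fst (.const i)

theorem codes_realize [IsJumpIdeal X] {k n : ℕ} (φ : (arithLang X).BoundedFormula (Fin k) n) :
    Codes X fun v : (Fin k → ℕ) × (Fin n → ℕ) => φ.Realize v.1 v.2 := by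
  induction φ with
  | falsum => exact ⟨∅, IsTuringIdeal.isSetAlgebra.empty_mem, fun _ => Iff.rfl⟩
  | equal s t =>
    have heq : ComputablePred fun q : ℕ × ℕ => q.1 = q.2 := Primrec.eq.computablePred
    exact (Codes.of_computablePred heq).comp
      ((computable_realize_term s).pair (computable_realize_term t))
  | rel R ts =>
    cases R with
    | lt =>
      have hlt : ComputablePred fun q : ℕ × ℕ => q.1 < q.2 := Primrec.nat_lt.computablePred
      exact (Codes.of_computablePred hlt).comp
        ((computable_realize_term (ts 0)).pair (computable_realize_term (ts 1)))
    | pred A => exact Codes.mem A.2 (computable_realize_term (ts 0))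
  | imp _ _ ih₁ ih₂ => exact ih₁.imp ih₂
  | @all n _ ih =>
    have hsnoc : Computable fun r : ((Fin k → ℕ) × (Fin n → ℕ)) × ℕ =>
        (r.1.1, (Fin.snoc r.1.2 r.2 : Fin (n + 1) → ℕ)) :=
      ((Primrec.fst.comp .fst).pair ((primrec_finSnoc n).comp (.comp .snd .fst) .snd)).to_comp
    exact (ih.comp hsnoc).all

theorem IsJumpIdeal.arithmeticallyClosed [IsJumpIdeal X] : ArithmeticallyClosed X := by
  intro B hB
  obtain ⟨φ, hφ⟩ := Set.empty_definable_iff.1 hB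
  have hconst : Computable fun n : ℕ => ((fun _ => n : Fin 1 → ℕ), (Fin.elim0 : Fin 0 → ℕ)) :=
    (Primrec.fin_curry.2 Primrec.fst.to₂).to_comp.pair (.const _)
  refine Codes.nat_iff.1 (((codes_realize φ).comp hconst).of_iff fun n => ?_)
  refine (Set.ext_iff.1 hφ fun _ => n).trans (iff_of_eq ?_)
  exact congrArg (BoundedFormula.Realize φ fun _ => n) (Subsingleton.elim _ _)

section Definability

variable {S : Set (Set ℕ)} {α : Type*} {f g : (α → ℕ) → ℕ}

theorem definable_lt (hf : (∅ : Set ℕ).DefinableFun (arithLang S) f)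
    (hg : (∅ : Set ℕ).DefinableFun (arithLang S) g) :
    (∅ : Set ℕ).Definable (arithLang S) {v | f v < g v} := by
  have hlt : (∅ : Set ℕ).Definable (arithLang S) {w : Fin 2 → ℕ | w 0 < w 1} :=
    Set.empty_definable_iff.2 ⟨Relations.formula (L := arithLang S) ArithRel.lt Term.var, rfl⟩
  have hmap : (∅ : Set ℕ).DefinableMap (arithLang S) fun v => ![f v, g v] :=
    Fin.forall_fin_two.2 ⟨hf, hg⟩
  exact hlt.preimage_map hmap

theorem definable_mem (A : S) (hf : (∅ : Set ℕ).DefinableFun (arithLang S) f) :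
    (∅ : Set ℕ).Definable (arithLang S) {v | f v ∈ (A : Set ℕ)} := by
  have hpred : (∅ : Set ℕ).Definable (arithLang S) {w : Fin 1 → ℕ | w 0 ∈ (A : Set ℕ)} :=
    Set.empty_definable_iff.2
      ⟨Relations.formula (L := arithLang S) (ArithRel.pred A) Term.var, rfl⟩
  have hmap : (∅ : Set ℕ).DefinableMap (arithLang S) fun v => ![f v] :=
    Fin.forall_fin_one.2 hf
  exact hpred.preimage_map hmap

theorem definableFun_add (hf : (∅ : Set ℕ).DefinableFun (arithLang S) f)
    (hg : (∅ : Set ℕ).DefinableFun (arithLang S) g) :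
    (∅ : Set ℕ).DefinableFun (arithLang S) fun v => f v + g v := by
  have hmap : (∅ : Set ℕ).DefinableMap (arithLang S) fun v => ![f v, g v] :=
    Fin.forall_fin_two.2 ⟨hf, hg⟩
  exact (Set.DefinableFun.fun_symbol (L := arithLang S) ArithFunc.add).comp hmap

theorem definableFun_mul (hf : (∅ : Set ℕ).DefinableFun (arithLang S) f)
    (hg : (∅ : Set ℕ).DefinableFun (arithLang S) g) :
    (∅ : Set ℕ).DefinableFun (arithLang S) fun v => f v * g v := by
  have hmap : (∅ : Set ℕ).DefinableMap (arithLang S) fun v => ![f v, g v] :=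
    Fin.forall_fin_two.2 ⟨hf, hg⟩
  exact (Set.DefinableFun.fun_symbol (L := arithLang S) ArithFunc.mul).comp hmap

theorem definableFun_pair (hf : (∅ : Set ℕ).DefinableFun (arithLang S) f)
    (hg : (∅ : Set ℕ).DefinableFun (arithLang S) g) :
    (∅ : Set ℕ).DefinableFun (arithLang S) fun v => Nat.pair (f v) (g v) :=
  Set.DefinableFun.ite (definable_lt hf hg) (definableFun_add (definableFun_mul hg hg) hf)
    (definableFun_add (definableFun_add (definableFun_mul hf hf) hf) hg)

end Definability

theorem ArithmeticallyClosed.isJumpIdeal [IsTuringIdeal X] (h : ArithmeticallyClosed X) :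
    IsJumpIdeal X where
  proj_mem A hA := by
    have hpair : (∅ : Set ℕ).DefinableFun (arithLang X) fun w : Fin 1 ⊕ Fin 1 → ℕ =>
        Nat.pair (w (.inl 0)) (w (.inr 0)) :=
      definableFun_pair (.proj _) (.proj _)
    refine h _ ?_
    rw [Set.Definable₁]
    convert (definable_mem ⟨A, hA⟩ hpair).exists_of_finite using 1
    ext v
    exact ⟨fun ⟨m, hm⟩ => ⟨fun _ => m, hm⟩, fun ⟨u, hu⟩ => ⟨u 0, hu⟩⟩

theorem arithmeticallyClosed_iff_isJumpIdeal [IsTuringIdeal X] :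
    ArithmeticallyClosed X ↔ IsJumpIdeal X :=
  ⟨fun h => h.isJumpIdeal, fun _ => IsJumpIdeal.arithmeticallyClosed⟩

/-! ### Trees and pseudo-intersections in jump ideals -/

theorem length_restrict (P : Set ℕ) (n : ℕ) : (restrict P n).length = n := by
  simp [restrict]

open Classical in
theorem restrict_succ (P : Set ℕ) (n : ℕ) :
    restrict P (n + 1) = restrict P n ++ [decide (n ∈ P)] := by
  simp [restrict, List.range_succ]

theorem getD_restrict {P : Set ℕ} {n i : ℕ} (hi : i < n) :
    (restrict P n).getD i false = true ↔ i ∈ P := by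
  simp [restrict, hi]

theorem exists_mem_iff_restrict_mem (R : Set (List Bool)) :
    ∃ P : Set ℕ, ∀ n, n ∈ P ↔ restrict P n ∈ R := by
  classical
  let σ : ℕ → List Bool := fun n => n.rec [] fun _ τ => τ ++ [decide (τ ∈ R)]
  have hσ : ∀ n, restrict {n | σ n ∈ R} n = σ n := by
    intro n
    induction n with
    | zero => rfl
    | succ n ih => simp only [restrict_succ, ih, Set.mem_ofPred_eq]; rfl
  exact ⟨{n | σ n ∈ R}, fun n => by rw [hσ]; rfl⟩

theorem restrict_length_eq_iff {R : Set (List Bool)} {P : Set ℕ}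
    (hP : ∀ n, n ∈ P ↔ restrict P n ∈ R) (σ : List Bool) :
    restrict P σ.length = σ ↔ ∀ i < σ.length, (σ.getD i false = true ↔ σ.take i ∈ R) := by
  induction σ using List.reverseRecOn with
  | nil => simp [restrict]
  | append_singleton σ b ih =>
    have hinit : (∀ i < σ.length, ((σ ++ [b]).getD i false = true ↔ (σ ++ [b]).take i ∈ R)) ↔
        restrict P σ.length = σ := by
      refine (forall₂_congr fun i hi => ?_).trans ih.symm
      rw [List.getD_append _ _ _ _ hi, List.take_append_of_le_length hi.le]
    rw [List.length_append, List.length_singleton, restrict_succ, Nat.forall_lt_succ_right, hinit,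
      List.append_singleton_inj]
    refine and_congr_right fun hσ => ?_
    rw [List.take_left, List.getD_append_right _ _ _ _ le_rfl, hP, hσ]
    cases b <;> simp

theorem mem_of_mem_iff_restrict_mem [IsJumpIdeal X] {R : Set (List Bool)} {P : Set ℕ}
    (hP : ∀ n, n ∈ P ↔ restrict P n ∈ R) (hR : Codes X (· ∈ R)) : P ∈ X := by
  have hdigit : Codes X fun q : List Bool × ℕ => q.1.getD q.2 false = true :=
    .of_primrecPred (Primrec.eq.comp ((Primrec.list_getD false).comp .fst .snd) (.const true))
  have hprefix : Codes X fun q : List Bool × ℕ => q.1.take q.2 ∈ R :=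
    hR.comp (Primrec.list_take.comp .snd .fst).to_comp
  have hsegment : Codes X fun σ : List Bool => restrict P σ.length = σ :=
    ((hdigit.iff hprefix).forall_lt Primrec.list_length.to_comp).of_iff (restrict_length_eq_iff hP)
  have hlength : Codes X fun q : ℕ × List Bool => q.2.length = q.1 :=
    .of_primrecPred (Primrec.eq.comp (Primrec.list_length.comp .snd) .fst)
  refine Codes.nat_iff.1 ((hlength.and ((hsegment.and hR).comp .snd)).ex.of_iff fun n => ?_)
  refine (hP n).trans ⟨fun h => ⟨restrict P n, length_restrict P n, ?_, h⟩, ?_⟩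
  · simp only [length_restrict]
  · rintro ⟨σ, (rfl : σ.length = n), hσ, hmem⟩
    rwa [hσ]

theorem exists_isPath [IsJumpIdeal X] {T : Set (List Bool)} (hT : Codes X (· ∈ T))
    (hnil : [] ∈ T) (hext : ∀ σ ∈ T, ∃ b, σ ++ [b] ∈ T) : ∃ P ∈ X, IsPath T P := by
  -- the leftmost path turns right exactly where the left successor is missing
  obtain ⟨P, hP⟩ := exists_mem_iff_restrict_mem {σ | σ ++ [false] ∉ T}
  have hleft : Codes X fun σ : List Bool => σ ++ [false] ∈ T :=
    hT.comp (Primrec.list_concat.comp .id (.const false)).to_comp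
  refine ⟨P, mem_of_mem_iff_restrict_mem hP hleft.not, fun n => ?_⟩
  induction n with
  | zero => exact hnil
  | succ n ih =>
    rw [restrict_succ]
    by_cases hn : restrict P n ++ [false] ∈ T
    · have hnP : n ∉ P := fun h => (hP n).1 h hn
      simpa [hnP] using hn
    · have hnP : n ∈ P := (hP n).2 hn
      obtain ⟨b, hb⟩ := hext _ ih
      cases b
      · exact absurd hb hn
      · simpa [hnP] using hb

/-- The cell with index `σ` of the partition of `A` generated by the first `σ.length` terms of the
sequence `B`: the members `m` of `A` such that `m ∈ B i` exactly when the `i`-th entry of `σ` is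
`true`. -/
def cell (A : Set ℕ) (B : ℕ → Set ℕ) (σ : List Bool) : Set ℕ :=
  {m ∈ A | ∀ i < σ.length, (m ∈ B i ↔ σ.getD i false = true)}

variable {B : ℕ → Set ℕ}

theorem cell_nil : cell A B [] = A := by
  simp [cell]

theorem mem_cell_append {σ : List Bool} {b : Bool} {m : ℕ} :
    m ∈ cell A B (σ ++ [b]) ↔ m ∈ cell A B σ ∧ (m ∈ B σ.length ↔ b = true) := by
  simp only [cell, Set.mem_ofPred_eq, List.length_append, List.length_singleton,
    Nat.forall_lt_succ_right, List.getD_append_right _ _ _ _ le_rfl, Nat.sub_self,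
    List.getD_cons_zero, and_assoc]
  refine and_congr_right fun _ => and_congr_left fun _ => forall₂_congr fun i hi => ?_
  rw [List.getD_append _ _ _ _ hi]

theorem mem_cell_restrict {P : Set ℕ} {n m : ℕ} :
    m ∈ cell A B (restrict P n) ↔ m ∈ A ∧ ∀ i < n, (m ∈ B i ↔ i ∈ P) := by
  rw [cell, Set.mem_ofPred_eq, length_restrict]
  exact and_congr_right fun _ => forall₂_congr fun i hi => by rw [getD_restrict hi]

theorem exists_infinite_cell_append {σ : List Bool} (h : (cell A B σ).Infinite) :
    ∃ b, (cell A B (σ ++ [b])).Infinite := by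
  have hunion : cell A B σ = cell A B (σ ++ [true]) ∪ cell A B (σ ++ [false]) := by
    ext m
    simp only [Set.mem_union, mem_cell_append, Bool.false_eq_true]
    tauto
  rw [hunion, Set.infinite_union] at h
  exact h.elim (⟨_, ·⟩) (⟨_, ·⟩)

theorem Codes.mem_cell [IsTuringIdeal X] (hA : A ∈ X) (hB : CodedIn X B) :
    Codes X fun q : List Bool × ℕ => q.2 ∈ cell A B q.1 := by
  have hdigit : Codes X fun r : (List Bool × ℕ) × ℕ => r.1.1.getD r.2 false = true :=
    .of_primrecPred
      (Primrec.eq.comp ((Primrec.list_getD false).comp (.comp .fst .fst) .snd) (.const true))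
  have hterm : Codes X fun r : (List Bool × ℕ) × ℕ => r.1.2 ∈ B r.2 :=
    (Codes.codedIn_iff.1 hB).comp (Computable.snd.pair (.comp .snd .fst))
  exact (Codes.mem hA .snd).and
    ((hterm.iff hdigit).forall_lt (Primrec.list_length.comp .fst).to_comp)

theorem Codes.infinite_cell [IsJumpIdeal X] (hA : A ∈ X) (hB : CodedIn X B) :
    Codes X fun σ => (cell A B σ).Infinite := by
  have hmem : Codes X fun r : (List Bool × ℕ) × ℕ => r.2 ∈ cell A B r.1.1 :=
    (Codes.mem_cell hA hB).comp ((Computable.fst.comp .fst).pair .snd)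
  have hlt : Codes X fun r : (List Bool × ℕ) × ℕ => r.1.2 < r.2 :=
    .of_primrecPred (Primrec.nat_lt.comp (.comp .snd .fst) .snd)
  exact (hmem.and hlt).ex.all.of_iff fun _ => Set.infinite_iff_exists_gt

theorem exists_mem_forall_infinite_cell_restrict [IsJumpIdeal X] (hA : A ∈ X)
    (hinf : A.Infinite) (hB : CodedIn X B) :
    ∃ P ∈ X, ∀ n, (cell A B (restrict P n)).Infinite :=
  exists_isPath (T := {σ | (cell A B σ).Infinite}) (Codes.infinite_cell hA hB)
    (by rwa [Set.mem_ofPred_eq, cell_nil]) fun _ => exists_infinite_cell_append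

theorem Codes.isLeast [IsTuringIdeal X] {α : Type*} [Primcodable α] {E : α → Set ℕ}
    (hE : Codes X fun q : α × ℕ => q.2 ∈ E q.1) :
    Codes X fun q : α × ℕ => IsLeast (E q.1) q.2 := by
  have hbelow := (hE.comp (f := fun r : (α × ℕ) × ℕ => (r.1.1, r.2))
    ((Computable.fst.comp .fst).pair .snd)).not.forall_lt Computable.snd
  refine (hE.and hbelow).of_iff fun q => and_congr_right fun _ => ?_
  exact forall_congr' fun k => by rw [← not_lt]; exact imp_not_comm

theorem exists_mem_pseudoIntersection [IsTuringIdeal X] {E : ℕ → Set ℕ} (hE : Antitone E)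
    (hinf : ∀ n, (E n).Infinite) (hcoded : CodedIn X E) :
    ∃ C ∈ X, C.Infinite ∧ C ⊆ E 0 ∧ ∀ n, (C \ E n).Finite := by
  have hexists : ∀ n, ∃ m, IsLeast (E n ∩ Set.Ici n) m := fun n =>
    have ⟨m, hm, hnm⟩ := (hinf n).exists_gt n
    ⟨_, isLeast_csInf ⟨m, hm, hnm.le⟩⟩
  choose f hf using hexists
  have hleast : Codes X fun q : ℕ × ℕ => IsLeast (E q.1 ∩ Set.Ici q.1) q.2 :=
    Codes.isLeast (E := fun n => E n ∩ Set.Ici n) ((Codes.codedIn_iff.1 hcoded).and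
      (.of_primrecPred (Primrec.nat_le.comp .fst .snd)))
  have hrange : ∀ m, m ∈ Set.range f ↔ ∃ n < m + 1, IsLeast (E n ∩ Set.Ici n) m := by
    refine fun m => ⟨?_, fun ⟨n, _, hn⟩ => ⟨n, (hf n).unique hn⟩⟩
    rintro ⟨n, rfl⟩
    exact ⟨n, Nat.lt_succ_of_le (hf n).1.2, hf n⟩
  refine ⟨Set.range f, ?_, ?_, ?_, fun n => ?_⟩
  · exact Codes.nat_iff.1 (((hleast.comp (Computable.snd.pair .fst)).exists_lt
      Computable.succ).of_iff hrange)
  · refine Set.infinite_of_not_bddAbove (not_bddAbove_iff.2 fun n => ?_)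
    exact ⟨f (n + 1), ⟨n + 1, rfl⟩, (hf (n + 1)).1.2⟩
  · rintro _ ⟨n, rfl⟩
    exact hE (Nat.zero_le n) (hf n).1.1
  · refine ((Set.finite_Iio n).image f).subset ?_
    rintro _ ⟨⟨k, rfl⟩, hk⟩
    exact ⟨k, lt_of_not_ge fun hnk => hk (hE hnk (hf k).1.1), rfl⟩

theorem exists_mem_forall_finite_diff [IsJumpIdeal X] (hA : A ∈ X) (hinf : A.Infinite)
    (hB : CodedIn X B) :
    ∃ C ∈ X, C.Infinite ∧ C ⊆ A ∧ ∃ P ∈ X, ∀ n, (C \ {m | m ∈ B n ↔ n ∈ P}).Finite := by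
  obtain ⟨P, hP, hcell⟩ := exists_mem_forall_infinite_cell_restrict hA hinf hB
  have hanti : Antitone fun n => cell A B (restrict P n) := fun k n hkn m hm => by
    rw [mem_cell_restrict] at hm ⊢
    exact ⟨hm.1, fun i hi => hm.2 i (hi.trans_le hkn)⟩
  have hcoded : CodedIn X fun n => cell A B (restrict P n) := by
    have hBP : Codes X fun r : (ℕ × ℕ) × ℕ => r.1.2 ∈ B r.2 ↔ r.2 ∈ P :=
      ((Codes.codedIn_iff.1 hB).comp (Computable.snd.pair (.comp .snd .fst))).iff
        (Codes.mem hP .snd)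
    exact Codes.codedIn_iff.2 (((Codes.mem hA .snd).and (hBP.forall_lt .fst)).of_iff
      fun _ => mem_cell_restrict)
  obtain ⟨C, hC, hCinf, hCA, hCP⟩ := exists_mem_pseudoIntersection hanti hcell hcoded
  exact ⟨C, hC, hCinf, fun m hm => (mem_cell_restrict.1 (hCA hm)).1, P, hP, fun n =>
    (hCP (n + 1)).subset (Set.sdiff_subset_sdiff_right fun m hm =>
      (mem_cell_restrict.1 hm).2 n n.lt_succ_self)⟩

/-! ### Ultrafilters on Turing ideals -/

theorem isUltrafilterOn_trace (hX : MeasureTheory.IsSetAlgebra X) (V : Ultrafilter ℕ) :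
    IsUltrafilterOn X {A ∈ X | A ∈ V} where
  subset _ hA := hA.1
  univ_mem := ⟨hX.univ_mem, univ_mem⟩
  empty_notMem h := V.empty_notMem h.2
  inter_mem _ hA _ hB := ⟨hX.inter_mem hA.1 hB.1, inter_mem hA.2 hB.2⟩
  mem_of_superset _ hA _ hB hAB := ⟨hB, mem_of_superset hA.2 hAB⟩
  mem_or_compl_mem A hA := (V.mem_or_compl_mem A).imp (⟨hA, ·⟩) (⟨hX.compl_mem hA, ·⟩)

theorem IsUltrafilterOn.exists_ultrafilter {U : Set (Set ℕ)} (hU : IsUltrafilterOn X U) :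
    ∃ V : Ultrafilter ℕ, ∀ A ∈ X, A ∈ U ↔ A ∈ V := by
  let F : Filter ℕ :=
    { sets := {A | ∃ D ∈ U, D ⊆ A}
      univ_sets := ⟨_, hU.univ_mem, subset_rfl⟩
      sets_of_superset := fun ⟨D, hD, hDA⟩ hAB => ⟨D, hD, hDA.trans hAB⟩
      inter_sets := fun ⟨D, hD, hDA⟩ ⟨E, hE, hEB⟩ =>
        ⟨D ∩ E, hU.inter_mem D hD E hE, Set.inter_subset_inter hDA hEB⟩ }
  have hF : ∀ A ∈ U, A ∈ F := fun A hA => ⟨A, hA, subset_rfl⟩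
  have : F.NeBot := neBot_iff.2 <| empty_mem_iff_bot.not.1 fun ⟨D, hD, hDempty⟩ =>
    hU.empty_notMem (Set.subset_empty_iff.1 hDempty ▸ hD)
  obtain ⟨V, hV⟩ := Ultrafilter.exists_le F
  refine ⟨V, fun A hA => ⟨fun h => hV (hF A h), fun h => ?_⟩⟩
  refine (hU.mem_or_compl_mem A hA).resolve_right fun hc => ?_
  exact Ultrafilter.compl_mem_iff_notMem.1 (hV (hF _ hc)) h

theorem CodedIn.mem [IsTuringIdeal X] (hB : CodedIn X B) (n : ℕ) : B n ∈ X :=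
  Codes.nat_iff.1 ((Codes.codedIn_iff.1 hB).comp ((Computable.const n).pair .id))

theorem decides_iff_forall_ultrafilter [IsTuringIdeal X] {C : ModFin X} (hB : CodedIn X B) :
    Decides C B ↔ ∀ V : Ultrafilter ℕ, C.1 ∈ V → {n | B n ∈ V} ∈ X := by
  refine ⟨fun h V hV => ?_, fun h U hU hCU => ?_⟩
  · simpa only [Set.mem_ofPred_eq, hB.mem, true_and] using
      h _ (isUltrafilterOn_trace IsTuringIdeal.isSetAlgebra V) ⟨C.2.1, hV⟩
  · obtain ⟨V, hV⟩ := hU.exists_ultrafilter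
    simpa only [hV _ (hB.mem _)] using h V ((hV C.1 C.2.1).1 hCU)

theorem decides_of_forall_finite_diff [IsTuringIdeal X] {C : ModFin X} (hB : CodedIn X B)
    {P : Set ℕ} (hP : P ∈ X) (h : ∀ n, (C.1 \ {m | m ∈ B n ↔ n ∈ P}).Finite) : Decides C B := by
  refine (decides_iff_forall_ultrafilter hB).2 fun V hCV => ?_
  rcases V.le_cofinite_or_eq_pure with hV | ⟨m, rfl⟩
  · suffices {n | B n ∈ V} = P by rwa [this]
    ext n
    have hn : ∀ᶠ m in V, m ∈ B n ↔ n ∈ P := by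
      filter_upwards [hCV, hV (h n).compl_mem_cofinite] with m hmC hm
      exact not_not.1 fun hne => hm ⟨hmC, hne⟩
    exact (eventually_congr hn).trans eventually_const
  · exact Codes.nat_iff.1 ((Codes.codedIn_iff.1 hB).comp (Computable.id.pair (.const m)))

theorem IsJumpIdeal.decisive [IsJumpIdeal X] : Decisive X := by
  intro B hB A
  obtain ⟨C, hC, hCinf, hCA, P, hP, hCP⟩ := exists_mem_forall_finite_diff A.2.1 A.2.2 hB
  have hle : (C \ A.1).Finite := Set.sdiff_eq_empty.2 hCA ▸ Set.finite_empty
  exact ⟨⟨C, hC, hCinf⟩, decides_of_forall_finite_diff hB hP hCP, hle⟩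

theorem Decisive.exists_decides [IsTuringIdeal X] (h : Decisive X) (hB : CodedIn X B) :
    ∃ C : ModFin X, Decides C B :=
  have ⟨C, hC, _⟩ :=
    h B hB ⟨Set.univ, IsTuringIdeal.isSetAlgebra.univ_mem, Set.infinite_univ⟩
  ⟨C, hC⟩

theorem isJumpIdeal_of_exists_decides [IsTuringIdeal X]
    (h : ∀ B, CodedIn X B → ∃ C : ModFin X, Decides C B) : IsJumpIdeal X where
  proj_mem A hA := by
    let B (n : ℕ) : Set ℕ := {m | ∃ k < m, Nat.pair n k ∈ A}
    have hpair : Codes X fun r : (ℕ × ℕ) × ℕ => Nat.pair r.1.1 r.2 ∈ A :=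
      Codes.mem hA (Primrec₂.natPair.comp (.comp .fst .fst) .snd).to_comp
    have hB : CodedIn X B := Codes.codedIn_iff.2 (hpair.exists_lt .snd)
    obtain ⟨C, hC⟩ := h B hB
    have := C.2.2.cofinite_inf_principal_neBot
    obtain ⟨V, hV⟩ := Ultrafilter.exists_le (cofinite ⊓ 𝓟 C.1)
    have hproj : ∀ n, B n ∈ V ↔ ∃ k, Nat.pair n k ∈ A := by
      refine fun n => ⟨fun hn => ?_, fun ⟨k, hk⟩ => ?_⟩
      · obtain ⟨_, k, _, hk⟩ := V.nonempty_of_mem hn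
        exact ⟨k, hk⟩
      · have hk : Set.Ioi k ⊆ B n := fun m hm => ⟨k, hm, hk⟩
        refine mem_of_superset (hV (mem_inf_of_left ?_)) hk
        rw [Nat.cofinite_eq_atTop]
        exact Ioi_mem_atTop k
    simpa only [hproj] using
      (decides_iff_forall_ultrafilter hB).1 hC V (hV (mem_inf_of_right (mem_principal_self _)))

end ScottSets

theorem mainTheorem5_general (X : Set (Set ℕ)) [ScottSets.IsTuringIdeal X] :
    List.TFAE [
      ScottSets.ArithmeticallyClosed X,
      ScottSets.Decisive X,
      ∀ B : ℕ → Set ℕ, ScottSets.CodedIn X B →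
        ∃ C : ScottSets.ModFin X, ScottSets.Decides C B] := by
  rw [ScottSets.arithmeticallyClosed_iff_isJumpIdeal]
  tfae_have 1 → 2 := fun _ => ScottSets.IsJumpIdeal.decisive
  tfae_have 2 → 3 := fun h _ => h.exists_decides
  tfae_have 3 → 1 := ScottSets.isJumpIdeal_of_exists_decides
  tfae_finish

theorem mainTheorem5 (X : Set (Set ℕ)) (hX : ScottSets.IsScottSet X) :
    List.TFAE [
      ScottSets.ArithmeticallyClosed X,
      ScottSets.Decisive X,
      ∀ B : ℕ → Set ℕ, ScottSets.CodedIn X B →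
        ∃ C : ScottSets.ModFin X, ScottSets.Decides C B] :=
  have := hX.isTuringIdeal
  mainTheorem5_general X
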